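/- Let $q\ge 2$ be an integer, and let $\mathcal A_q=\{-q+1,-q+3,\dots,q-3,q-1\}$. A sequence $x=(x_1,\dots,x_n)\in\mathcal A_q^n$ is called charge balanced if $\sum_{i=1}^n x_i=0$, and polarity balanced if $|\{i:x_i>0\}|=|\{i:x_i<0\}|$; it is called CPB if it is both. Let $M_{\mathrm{CPB}}(n,q)$ be the number of CPB sequences in $\mathcal A_q^n$. A CPB code of length $n$ is a nonempty set $C\subseteq\mathcal A_q^n$ of CPB sequences, its redundancy is $n-\log_q|C|$, and $r_{\mathrm{CPB}}(n,q)$ denotes the minimum redundancy of CPB codes of length $n$ over $\mathcal A_q$. Let $q\ge 4$ be a fixed even integer. Then, as $n\to\infty$ through the even integers, $$M_{\mathrm{CPB}}(n,q)\sim q^n\,\frac{1}{\pi n}\sqrt{\frac{48}{q^2-4}},$$ in the sense that the ratio of the two sides tends to $1$. Moreover, for every even $n\ge 2$ the minimum $r_{\mathrm{CPB}}(n,q)$ exists and $$r_{\mathrm{CPB}}(n,q)=n-\log_q M_{\mathrm{CPB}}(n,q),$$ and, as $n\to\infty$ through the even integers, $$r_{\mathrm{CPB}}(n,q)-\left(\log_q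 n+\log_q\!\left(\pi\sqrt{\frac{q^2-4}{48}}\right)\right)\to 0 .$$ In particular the asymptotic normalized redundancy is $$\lim_{n\to\infty,\ n\text{ even}}\frac{r_{\mathrm{CPB}}(n,q)}{\log_q n}=1 .$$ -/

import Mathlib

open Filter Topology Asymptotics

/-- The alphabet `{-q+1, -q+3, …, q-3, q-1}` of `q` integers. -/
def pamAlphabet (q : ℕ) : Finset ℤ :=
  (Finset.range q).image (fun j : ℕ => -(q : ℤ) + 1 + 2 * (j : ℤ))

/-- The set of all sequences of length `n` over the alphabet. -/
def pamSequences (n q : ℕ) : Finset (Fin n → ℤ) :=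
  Fintype.piFinset (fun _ : Fin n => pamAlphabet q)

/-- Charge balance: the symbols add up to zero. -/
def IsChargeBalanced {n : ℕ} (x : Fin n → ℤ) : Prop :=
  ∑ i, x i = 0

/-- Polarity balance: as many positive as negative symbols. -/
def IsPolarityBalanced {n : ℕ} (x : Fin n → ℤ) : Prop :=
  (Finset.univ.filter (fun i => 0 < x i)).card = (Finset.univ.filter (fun i => x i < 0)).card

open Classical in
/-- The set of all sequences of length `n` over the alphabet that are both charge balanced and
polarity balanced. -/
noncomputable def cpbSequences (n q : ℕ) : Finset (Fin n → ℤ) :=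
  (pamSequences n q).filter (fun x => IsChargeBalanced x ∧ IsPolarityBalanced x)

/-- The number of charge and polarity balanced sequences. -/
noncomputable def cpbCount (n q : ℕ) : ℕ := (cpbSequences n q).card

/-- A code is a set of sequences of length `n` over the alphabet; it is nonempty, so that its
redundancy is defined. It is a CPB code if each codeword is charge and polarity balanced. -/
def IsCPBCode (n q : ℕ) (C : Finset (Fin n → ℤ)) : Prop :=
  C.Nonempty ∧ C ⊆ pamSequences n q ∧ ∀ x ∈ C, IsChargeBalanced x ∧ IsPolarityBalanced x

/-- The redundancy `n - log_q M` of a `q`-ary code of length `n` and size `M`. -/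
noncomputable def codeRedundancy (n q : ℕ) (C : Finset (Fin n → ℤ)) : ℝ :=
  (n : ℝ) - Real.logb q (C.card : ℝ)

/-- The redundancies of all CPB codes of length `n`. -/
def cpbRedundancies (n q : ℕ) : Set ℝ :=
  {r : ℝ | ∃ C : Finset (Fin n → ℤ), IsCPBCode n q C ∧ r = codeRedundancy n q C}

/-- The minimum redundancy of a CPB code of length `n`. -/
noncomputable def minCPBRedundancy (n q : ℕ) : ℝ := sInf (cpbRedundancies n q)

/-- The filter `n → ∞` along the even natural numbers. -/
def atTopEven : Filter ℕ := atTop ⊓ 𝓟 {n : ℕ | Even n}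

/-! Write `q = 2m`, `n = 2k`. No symbol is zero, so polarity balance means exactly `k` positive
entries. Fix their positions: by Fourier inversion, the charge balanced sequences with that sign
pattern number `(1/2π) ∫ P(θ)^k P(-θ)^k`, where `P(θ) = ∑ exp(i(2j+1)θ)` over `j < m`. Since
`P(θ)P(-θ) = |P(θ)|²` is a cosine sum in `2θ`, the count does not depend on the pattern, and `M =
C(2k,k) · (1/2π) ∫ cosSum^k` exactly. Stirling gives `C(2k,k) ~ 4^k / √(πk)`, and Laplace's method
gives `∫ cosSum^k ~ m^(2k) √(π/(vk))` with `v = (m²-1)/12`. The product is `q^n / (πn√v)`, and `1/√v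
= √(48/(q²-4))`. The largest CPB code is the set of all CPB sequences, so the redundancy statements
follow by taking logarithms. -/

/-! ### Fourier integrals and the cosine sum. -/

lemma integral_exp_int_mul_I (N : ℤ) :
    ∫ θ in (-Real.pi)..Real.pi, Complex.exp (N * θ * Complex.I) =
      if N = 0 then 2 * (Real.pi : ℂ) else 0 := by
  split_ifs with h
  · simp [h]; ring
  · have hc : (N : ℂ) * Complex.I ≠ 0 := by simp [h]
    have h1 : ∀ θ : ℝ, Complex.exp (N * θ * Complex.I) = Complex.exp (N * Complex.I * θ) := by
      intro θ; ring_nf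
    simp_rw [h1]
    rw [integral_exp_mul_complex hc]
    have h2 : Complex.exp (N * Complex.I * (Real.pi : ℝ)) =
        Complex.exp (N * Complex.I * ((-Real.pi : ℝ) : ℂ)) := by
      rw [Complex.exp_eq_exp_iff_exists_int]
      exact ⟨N, by push_cast; ring⟩
    rw [h2, sub_self, zero_div]

/-- The number of points of a finite box of integers with coordinate sum zero, as a Fourier
integral. -/
lemma card_sum_eq_zero_eq_integral {n : ℕ} (A : Fin n → Finset ℤ) :
    ((((Fintype.piFinset A).filter (fun x => ∑ i, x i = 0)).card : ℕ) : ℂ) * (2 * Real.pi) =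
      ∫ θ in (-Real.pi)..Real.pi,
        ∏ i, ∑ a ∈ A i, Complex.exp (a * (θ : ℂ) * Complex.I) := by
  have h : ∀ θ : ℝ, ∏ i, ∑ a ∈ A i, Complex.exp (a * (θ : ℂ) * Complex.I) =
      ∑ x ∈ Fintype.piFinset A, Complex.exp (((∑ i, x i : ℤ) : ℂ) * θ * Complex.I) := by
    intro θ
    rw [Finset.prod_univ_sum]
    refine Finset.sum_congr rfl fun x _ => ?_
    rw [← Complex.exp_sum]
    push_cast
    rw [Finset.sum_mul, Finset.sum_mul]
  simp_rw [h]
  rw [intervalIntegral.integral_finsetSum]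
  · simp_rw [integral_exp_int_mul_I]
    -- By orthogonality only the zero-sum points survive, each contributing `2π`.
    rw [← Finset.sum_filter, Finset.sum_const, nsmul_eq_mul]
  · intro x _
    apply Continuous.intervalIntegrable
    fun_prop

/-- The squared modulus of `∑ j < m, exp (i j t)`, as a sum of cosines. -/
noncomputable def cosSum (m : ℕ) (t : ℝ) : ℝ :=
  ∑ j ∈ Finset.range m, ∑ l ∈ Finset.range m, Real.cos (((j : ℝ) - l) * t)

lemma continuous_cosSum (m : ℕ) : Continuous (cosSum m) := by
  unfold cosSum
  fun_prop

/-- The imaginary part vanishes because swapping `j` and `l` changes the sign of the sine. -/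
lemma ofReal_cosSum (m : ℕ) (t : ℝ) :
    (cosSum m t : ℂ) = ∑ j ∈ Finset.range m, ∑ l ∈ Finset.range m,
      Complex.exp (((j : ℂ) - l) * t * Complex.I) := by
  have hs : ∑ j ∈ Finset.range m, ∑ l ∈ Finset.range m, Real.sin (((j : ℝ) - l) * t) = 0 := by
    have h1 : ∑ j ∈ Finset.range m, ∑ l ∈ Finset.range m, Real.sin (((j : ℝ) - l) * t) =
        -∑ j ∈ Finset.range m, ∑ l ∈ Finset.range m, Real.sin (((j : ℝ) - l) * t) := by
      conv_lhs => rw [Finset.sum_comm]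
      rw [← Finset.sum_neg_distrib]
      refine Finset.sum_congr rfl fun j _ => ?_
      rw [← Finset.sum_neg_distrib]
      refine Finset.sum_congr rfl fun l _ => ?_
      rw [← Real.sin_neg]
      ring_nf
    linarith
  have hs' : ∑ j ∈ Finset.range m, ∑ l ∈ Finset.range m,
      Complex.sin (((j : ℂ) - l) * t) = 0 := by
    exact_mod_cast congrArg (fun r : ℝ => (r : ℂ)) hs
  simp_rw [Complex.exp_mul_I, Finset.sum_add_distrib, ← Finset.sum_mul]
  rw [hs', cosSum]
  push_cast
  ring

lemma periodic_cosSum_pow (m k : ℕ) :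
    Function.Periodic (fun t => cosSum m t ^ k) (2 * Real.pi) := by
  intro t
  have : cosSum m (t + 2 * Real.pi) = cosSum m t := by
    unfold cosSum
    refine Finset.sum_congr rfl fun j _ => Finset.sum_congr rfl fun l _ => ?_
    have := Real.cos_add_int_mul_two_pi (((j : ℝ) - l) * t) ((j : ℤ) - l)
    rw [← this]
    push_cast
    ring_nf
  simp only [this]

/-- The substitution `t = 2θ` covers two full periods, which the Jacobian `1/2` compensates. -/
lemma integral_cosSum_two_mul_pow (m k : ℕ) :
    ∫ θ in (-Real.pi)..Real.pi, cosSum m (2 * θ) ^ k =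
      ∫ θ in (-Real.pi)..Real.pi, cosSum m θ ^ k := by
  have hi : ∀ a b : ℝ, IntervalIntegrable (fun t => cosSum m t ^ k) MeasureTheory.volume a b :=
    fun a b => ((continuous_cosSum m).pow k).intervalIntegrable a b
  rw [intervalIntegral.integral_comp_mul_left (fun t => cosSum m t ^ k) two_ne_zero]
  have h1 := (periodic_cosSum_pow m k).intervalIntegral_add_eq (-(2 * Real.pi)) (-Real.pi)
  have h2 := (periodic_cosSum_pow m k).intervalIntegral_add_eq 0 (-Real.pi)
  have e1 : -(2 * Real.pi) + 2 * Real.pi = 0 := by ring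
  have e2 : -Real.pi + 2 * Real.pi = Real.pi := by ring
  rw [e1, e2] at h1
  rw [e2, zero_add] at h2
  rw [mul_neg, ← intervalIntegral.integral_add_adjacent_intervals (hi _ 0) (hi 0 _), h1, h2,
    smul_eq_mul]
  ring

/-! ### Sign patterns and the exact count. -/

lemma mem_pamAlphabet_two_mul {m : ℕ} {a : ℤ} :
    a ∈ pamAlphabet (2 * m) ↔ a % 2 = 1 ∧ -(2 * m : ℤ) < a ∧ a < 2 * m := by
  simp only [pamAlphabet, Finset.mem_image, Finset.mem_range]
  constructor
  · rintro ⟨j, hj, rfl⟩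
    push_cast
    omega
  · rintro ⟨h1, h2, h3⟩
    refine ⟨((a + 2 * m - 1) / 2).toNat, ?_, ?_⟩ <;> push_cast <;> omega

/-- The symbols of the alphabet of a given polarity. -/
def polarSymbols (m : ℕ) (positive : Prop) [Decidable positive] : Finset ℤ :=
  (Finset.range m).image (fun j : ℕ => if positive then 2 * (j : ℤ) + 1 else -(2 * (j : ℤ) + 1))

lemma mem_polarSymbols {m : ℕ} {p : Prop} [Decidable p] {a : ℤ} :
    a ∈ polarSymbols m p ↔ a ∈ pamAlphabet (2 * m) ∧ (0 < a ↔ p) := by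
  rw [mem_pamAlphabet_two_mul]
  simp only [polarSymbols, Finset.mem_image, Finset.mem_range]
  by_cases hp : p
  · simp only [hp, if_true, iff_true]
    constructor
    · rintro ⟨j, hj, rfl⟩
      omega
    · rintro ⟨⟨h1, h2, h3⟩, h4⟩
      exact ⟨((a - 1) / 2).toNat, by omega, by omega⟩
  · simp only [hp, if_false, iff_false]
    constructor
    · rintro ⟨j, hj, rfl⟩
      omega
    · rintro ⟨⟨h1, h2, h3⟩, h4⟩
      exact ⟨((-a - 1) / 2).toNat, by omega, by omega⟩

lemma sum_polarSymbols {M : Type*} [AddCommMonoid M] (m : ℕ) (p : Prop) [Decidable p]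
    (f : ℤ → M) :
    ∑ a ∈ polarSymbols m p, f a =
      ∑ j ∈ Finset.range m, f (if p then 2 * (j : ℤ) + 1 else -(2 * (j : ℤ) + 1)) := by
  rw [polarSymbols, Finset.sum_image]
  intro i _ j _ h
  dsimp only at h
  split_ifs at h <;> omega

/-- The two factors are complex conjugates. The argument is `2θ` because symbols of one polarity are
spaced by 2. -/
lemma sum_exp_polarSymbols_mul (m : ℕ) (θ : ℝ) :
    (∑ a ∈ polarSymbols m True, Complex.exp (a * (θ : ℂ) * Complex.I)) *
      (∑ a ∈ polarSymbols m False, Complex.exp (a * (θ : ℂ) * Complex.I)) =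
      (cosSum m (2 * θ) : ℂ) := by
  rw [sum_polarSymbols, sum_polarSymbols, ofReal_cosSum, Finset.sum_mul_sum]
  refine Finset.sum_congr rfl fun j _ => Finset.sum_congr rfl fun l _ => ?_
  rw [← Complex.exp_add]
  congr 1
  simp only [if_true, if_false]
  push_cast
  ring

lemma card_polar_sum_eq_zero {k m : ℕ} {s : Finset (Fin (2 * k))} (hs : s.card = k) :
    ((((Fintype.piFinset fun i => polarSymbols m (i ∈ s)).filter
      (fun x => ∑ i, x i = 0)).card : ℕ) : ℝ) * (2 * Real.pi) =
      ∫ θ in (-Real.pi)..Real.pi, cosSum m θ ^ k := by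
  have h := card_sum_eq_zero_eq_integral (fun i : Fin (2 * k) => polarSymbols m (i ∈ s))
  have hp : ∀ θ : ℝ, ∏ i : Fin (2 * k), ∑ a ∈ polarSymbols m (i ∈ s),
      Complex.exp (a * (θ : ℂ) * Complex.I) = ((cosSum m (2 * θ) ^ k : ℝ) : ℂ) := by
    intro θ
    have h1 : ∀ i ∈ s, ∑ a ∈ polarSymbols m (i ∈ s), Complex.exp (a * (θ : ℂ) * Complex.I) =
        ∑ a ∈ polarSymbols m True, Complex.exp (a * (θ : ℂ) * Complex.I) := by
      intro i hi
      simp [polarSymbols, hi]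
    have h2 : ∀ i ∈ sᶜ, ∑ a ∈ polarSymbols m (i ∈ s), Complex.exp (a * (θ : ℂ) * Complex.I) =
        ∑ a ∈ polarSymbols m False, Complex.exp (a * (θ : ℂ) * Complex.I) := by
      intro i hi
      simp [polarSymbols, Finset.mem_compl.1 hi]
    have hc : sᶜ.card = k := by
      rw [Finset.card_compl, hs, Fintype.card_fin]
      omega
    rw [← Finset.prod_mul_prod_compl s, Finset.prod_congr rfl h1, Finset.prod_congr rfl h2,
      Finset.prod_const, Finset.prod_const, hs, hc, ← mul_pow, sum_exp_polarSymbols_mul]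
    push_cast
    rfl
  simp_rw [hp] at h
  rw [intervalIntegral.integral_ofReal, integral_cosSum_two_mul_pow] at h
  exact_mod_cast h

lemma isPolarityBalanced_iff_card_pos {k m : ℕ} {x : Fin (2 * k) → ℤ}
    (hx : x ∈ pamSequences (2 * k) (2 * m)) :
    IsPolarityBalanced x ↔ (Finset.univ.filter (fun i => 0 < x i)).card = k := by
  have h0 : ∀ i, x i < 0 ↔ ¬ 0 < x i := by
    intro i
    have := mem_pamAlphabet_two_mul.1 (Fintype.mem_piFinset.1 hx i)
    omega
  have h := Finset.card_filter_add_card_filter_not (s := (Finset.univ : Finset (Fin (2 * k))))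
    (fun i => 0 < x i)
  rw [Finset.card_univ, Fintype.card_fin] at h
  simp only [IsPolarityBalanced, h0]
  omega

/-- Fibre the sequences over their set of positive positions: there are `C(2k,k)` such sets, and all
fibres have the same size. -/
lemma cpbCount_two_mul (k m : ℕ) :
    (cpbCount (2 * k) (2 * m) : ℝ) * (2 * Real.pi) =
      Nat.centralBinom k * ∫ θ in (-Real.pi)..Real.pi, cosSum m θ ^ k := by
  classical
  have hmap : ∀ x ∈ cpbSequences (2 * k) (2 * m),
      Finset.univ.filter (fun i => 0 < x i) ∈
        Finset.powersetCard k (Finset.univ : Finset (Fin (2 * k))) := by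
    intro x hx
    obtain ⟨h1, h2, h3⟩ := Finset.mem_filter.1 hx
    exact Finset.mem_powersetCard.2
      ⟨Finset.subset_univ _, (isPolarityBalanced_iff_card_pos h1).1 h3⟩
  have hfib : ∀ s ∈ Finset.powersetCard k (Finset.univ : Finset (Fin (2 * k))),
      (cpbSequences (2 * k) (2 * m)).filter
        (fun x => Finset.univ.filter (fun i => 0 < x i) = s) =
      (Fintype.piFinset fun i => polarSymbols m (i ∈ s)).filter (fun x => ∑ i, x i = 0) := by
    intro s hs
    have hs := (Finset.mem_powersetCard.1 hs).2
    ext x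
    simp only [cpbSequences, Finset.mem_filter, Fintype.mem_piFinset, mem_polarSymbols,
      forall_and]
    constructor
    · rintro ⟨⟨h1, h2, -⟩, rfl⟩
      exact ⟨⟨Fintype.mem_piFinset.1 h1, fun i => by simp⟩, h2⟩
    · rintro ⟨⟨h1, h2⟩, h3⟩
      have h4 : x ∈ pamSequences (2 * k) (2 * m) := Fintype.mem_piFinset.2 h1
      have h5 : Finset.univ.filter (fun i => 0 < x i) = s := by
        ext i
        simp [h2]
      exact ⟨⟨h4, h3, (isPolarityBalanced_iff_card_pos h4).2 (by rw [h5, hs])⟩, h5⟩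
  rw [cpbCount, Finset.card_eq_sum_card_fiberwise hmap, Nat.cast_sum, Finset.sum_mul]
  rw [Finset.sum_congr rfl fun s hs => by
    rw [hfib s hs, card_polar_sum_eq_zero (Finset.mem_powersetCard.1 hs).2]]
  rw [Finset.sum_const, Finset.card_powersetCard, Finset.card_univ, Fintype.card_fin,
    nsmul_eq_mul, Nat.centralBinom_eq_two_mul_choose]

/-! ### Laplace's method for the integral. -/

/-- Supplies the quadratic coefficient of `cosSum` at 0, hence the constant `(m² - 1)/12`. -/
lemma sum_range_sum_range_sub_sq (m : ℕ) :
    ∑ j ∈ Finset.range m, ∑ l ∈ Finset.range m, ((j : ℝ) - l) ^ 2 =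
      (m : ℝ) ^ 2 * ((m : ℝ) ^ 2 - 1) / 6 := by
  have h1 : ∀ n : ℕ, ∑ j ∈ Finset.range n, (j : ℝ) = n * (n - 1) / 2 := by
    intro n
    induction n with
    | zero => simp
    | succ n ih => rw [Finset.sum_range_succ, ih]; push_cast; ring
  have h2 : ∀ n : ℕ, ∑ j ∈ Finset.range n, (j : ℝ) ^ 2 = n * (n - 1) * (2 * n - 1) / 6 := by
    intro n
    induction n with
    | zero => simp
    | succ n ih => rw [Finset.sum_range_succ, ih]; push_cast; ring
  simp_rw [sub_sq, Finset.sum_add_distrib, Finset.sum_sub_distrib, mul_assoc, ← Finset.mul_sum,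
    ← Finset.sum_mul, h1, h2, Finset.sum_const, Finset.card_range, nsmul_eq_mul,
    ← Finset.mul_sum, h2]
  ring

lemma cosSum_eq_sq_sub (m : ℕ) (t : ℝ) :
    cosSum m t = (m : ℝ) ^ 2 -
      ∑ j ∈ Finset.range m, ∑ l ∈ Finset.range m, (1 - Real.cos (((j : ℝ) - l) * t)) := by
  simp [cosSum, Finset.sum_sub_distrib]
  ring

lemma cosSum_nonneg (m : ℕ) (t : ℝ) : 0 ≤ cosSum m t := by
  have h : cosSum m t = (∑ j ∈ Finset.range m, Real.cos (j * t)) ^ 2 +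
      (∑ j ∈ Finset.range m, Real.sin (j * t)) ^ 2 := by
    simp_rw [cosSum, sq, Finset.sum_mul_sum, ← Finset.sum_add_distrib, sub_mul, Real.cos_sub]
  rw [h]
  positivity

/-- All terms `1 - cos` are nonnegative, so keeping only `j = 1`, `l = 0` (available as `m ≥ 2`)
gives a crude bound, enough for domination. -/
lemma cosSum_le {m : ℕ} (hm : 2 ≤ m) (t : ℝ) :
    cosSum m t ≤ (m : ℝ) ^ 2 - (1 - Real.cos t) := by
  have h0 : ∀ j l : ℕ, 0 ≤ 1 - Real.cos (((j : ℝ) - l) * t) := fun j l =>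
    sub_nonneg.2 (Real.cos_le_one _)
  have h1 : 1 - Real.cos t ≤ ∑ l ∈ Finset.range m, (1 - Real.cos ((((1 : ℕ) : ℝ) - l) * t)) := by
    have := Finset.single_le_sum (f := fun l : ℕ => 1 - Real.cos ((((1 : ℕ) : ℝ) - l) * t))
      (fun l _ => h0 1 l) (Finset.mem_range.2 (show 0 < m by omega))
    simpa using this
  have h2 := Finset.single_le_sum
    (f := fun j : ℕ => ∑ l ∈ Finset.range m, (1 - Real.cos (((j : ℝ) - l) * t)))
    (fun j _ => Finset.sum_nonneg fun l _ => h0 j l)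
    (Finset.mem_range.2 (show 1 < m by omega))
  rw [cosSum_eq_sq_sub]
  linarith

/-- Gaussian majorant on a whole period, from `cos t ≤ 1 - (2/π²)t²` and `1 + x ≤ exp x`. -/
lemma cosSum_div_sq_le_exp {m : ℕ} (hm : 2 ≤ m) {t : ℝ} (ht : |t| ≤ Real.pi) :
    cosSum m t / (m : ℝ) ^ 2 ≤ Real.exp (-(2 / (Real.pi ^ 2 * (m : ℝ) ^ 2)) * t ^ 2) := by
  have hm0 : (0 : ℝ) < (m : ℝ) ^ 2 := by positivity
  have h := cosSum_le hm t
  have h' := Real.cos_le_one_sub_mul_cos_sq ht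
  calc cosSum m t / (m : ℝ) ^ 2 ≤ ((m : ℝ) ^ 2 - 2 / Real.pi ^ 2 * t ^ 2) / (m : ℝ) ^ 2 := by
        gcongr
        linarith
    _ = -(2 / (Real.pi ^ 2 * (m : ℝ) ^ 2)) * t ^ 2 + 1 := by
        have := Real.pi_pos
        field_simp
        ring
    _ ≤ _ := Real.add_one_le_exp _

lemma tendsto_mul_one_sub_cos_div_sqrt (a : ℝ) :
    Tendsto (fun k : ℕ => (k : ℝ) * (1 - Real.cos (a / √k))) atTop (𝓝 (a ^ 2 / 2)) := by
  have h1 : Tendsto (fun k : ℕ => a / 2 / √(k : ℝ)) atTop (𝓝 0) :=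
    tendsto_const_nhds.div_atTop (Real.tendsto_sqrt_atTop.comp tendsto_natCast_atTop_atTop)
  -- The half-angle formula turns `1 - cos` into a squared sine, hence a squared `sinc`, continuous
  -- at 0.
  have h2 : Tendsto (fun k : ℕ => a ^ 2 / 2 * Real.sinc (a / 2 / √(k : ℝ)) ^ 2) atTop
      (𝓝 (a ^ 2 / 2 * Real.sinc 0 ^ 2)) :=
    (((Real.continuous_sinc.tendsto 0).comp h1).pow 2).const_mul _
  rw [Real.sinc_zero, one_pow, mul_one] at h2
  refine h2.congr' ?_
  filter_upwards [eventually_gt_atTop 0] with k hk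
  have hk' : (0 : ℝ) < k := by exact_mod_cast hk
  have hs : (0 : ℝ) < √k := Real.sqrt_pos.2 hk'
  have hsq : √(k : ℝ) ^ 2 = k := Real.sq_sqrt hk'.le
  by_cases ha : a = 0
  · simp [ha]
  · have hx : a / 2 / √(k : ℝ) ≠ 0 := by positivity
    have hc : 1 - Real.cos (a / √k) = 2 * Real.sin (a / 2 / √k) ^ 2 := by
      have : a / √(k : ℝ) = 2 * (a / 2 / √k) := by ring
      rw [this, Real.cos_two_mul, Real.cos_sq']
      ring
    rw [hc, Real.sinc_of_ne_zero hx]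
    nth_rw 3 [← hsq]
    field_simp

/-- An instance of `(1 + x_k)^k → exp x` when `k x_k → x`; the limit `x` comes from the second-order
terms of the cosines. -/
lemma tendsto_cosSum_div_sqrt_pow {m : ℕ} (hm : 0 < m) (u : ℝ) :
    Tendsto (fun k : ℕ => (cosSum m (u / √k) / (m : ℝ) ^ 2) ^ k) atTop
      (𝓝 (Real.exp (-(((m : ℝ) ^ 2 - 1) / 12) * u ^ 2))) := by
  have hm0 : (m : ℝ) ≠ 0 := by positivity
  have h1 : Tendsto (fun k : ℕ => -(∑ j ∈ Finset.range m, ∑ l ∈ Finset.range m,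
      (k : ℝ) * (1 - Real.cos (((j : ℝ) - l) * u / √k))) / (m : ℝ) ^ 2) atTop
      (𝓝 (-(∑ j ∈ Finset.range m, ∑ l ∈ Finset.range m,
        (((j : ℝ) - l) * u) ^ 2 / 2) / (m : ℝ) ^ 2)) := by
    refine Tendsto.div_const (Tendsto.neg ?_) _
    exact tendsto_finsetSum _ fun j _ => tendsto_finsetSum _ fun l _ =>
      tendsto_mul_one_sub_cos_div_sqrt _
  have hlim : -(∑ j ∈ Finset.range m, ∑ l ∈ Finset.range m,
      (((j : ℝ) - l) * u) ^ 2 / 2) / (m : ℝ) ^ 2 = -(((m : ℝ) ^ 2 - 1) / 12) * u ^ 2 := by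
    simp_rw [mul_pow, ← Finset.sum_div, ← Finset.sum_mul, sum_range_sum_range_sub_sq]
    field_simp
    ring
  rw [hlim] at h1
  have h2 : Tendsto (fun k : ℕ => (k : ℝ) * (cosSum m (u / √k) / (m : ℝ) ^ 2 - 1)) atTop
      (𝓝 (-(((m : ℝ) ^ 2 - 1) / 12) * u ^ 2)) := by
    refine h1.congr fun k => ?_
    have e : ∀ j l : ℕ, ((j : ℝ) - l) * u / √k = ((j : ℝ) - l) * (u / √k) := fun j l =>
      mul_div_assoc _ _ _
    simp_rw [e, ← Finset.mul_sum]
    rw [cosSum_eq_sq_sub, sub_div, div_self (pow_ne_zero 2 hm0)]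
    ring
  simpa using Real.tendsto_one_add_pow_exp_of_tendsto h2

/-- Laplace's method for the powers of the normalised cosine sum. -/
lemma tendsto_sqrt_mul_integral_cosSum_pow {m : ℕ} (hm : 2 ≤ m) :
    Tendsto (fun k : ℕ => √k * ∫ θ in (-Real.pi)..Real.pi, (cosSum m θ / (m : ℝ) ^ 2) ^ k) atTop
      (𝓝 √(Real.pi / (((m : ℝ) ^ 2 - 1) / 12))) := by
  have hm0 : (0 : ℝ) < m := by positivity
  rw [← integral_gaussian]
  set c : ℝ := 2 / (Real.pi ^ 2 * (m : ℝ) ^ 2) with hc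
  have hcpos : 0 < c := by have := Real.pi_pos; positivity
  -- Rescale by `θ = u/√k` and extend by zero to the line. The `k`-th power of the Gaussian majorant
  -- at `u/√k` is `exp (-c u²)`, independent of `k`, so dominated convergence applies.
  have hdom : Tendsto (fun k : ℕ => ∫ u : ℝ,
      (Set.Ioc (-Real.pi * √k) (Real.pi * √k)).indicator
        (fun u => (cosSum m (u / √k) / (m : ℝ) ^ 2) ^ k) u) atTop
      (𝓝 (∫ u : ℝ, Real.exp (-(((m : ℝ) ^ 2 - 1) / 12) * u ^ 2))) := by
    refine MeasureTheory.tendsto_integral_filter_of_dominated_convergence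
      (fun u => Real.exp (-c * u ^ 2)) ?_ ?_ (integrable_exp_neg_mul_sq hcpos) ?_
    · refine Eventually.of_forall fun k => Measurable.aestronglyMeasurable ?_
      refine Measurable.indicator ?_ measurableSet_Ioc
      exact ((((continuous_cosSum m).comp (continuous_id.div_const _)).div_const _).pow k).measurable
    · filter_upwards [eventually_gt_atTop 0] with k hk
      have hk' : (0 : ℝ) < k := by exact_mod_cast hk
      have hs : (0 : ℝ) < √k := Real.sqrt_pos.2 hk'
      refine Eventually.of_forall fun u => ?_
      by_cases hu : u ∈ Set.Ioc (-Real.pi * √k) (Real.pi * √k)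
      · rw [Set.indicator_of_mem hu]
        have hu' : |u / √k| ≤ Real.pi := by
          rw [abs_div, abs_of_pos hs, div_le_iff₀ hs, abs_le]
          exact ⟨by linarith [hu.1], hu.2⟩
        have hn : 0 ≤ cosSum m (u / √k) / (m : ℝ) ^ 2 :=
          div_nonneg (cosSum_nonneg _ _) (by positivity)
        rw [Real.norm_of_nonneg (pow_nonneg hn k)]
        refine (pow_le_pow_left₀ hn (cosSum_div_sq_le_exp hm hu') k).trans_eq ?_
        rw [← Real.exp_nat_mul, div_pow, Real.sq_sqrt hk'.le]
        congr 1
        field_simp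
        rw [hc]
        field_simp
      · rw [Set.indicator_of_notMem hu, norm_zero]
        positivity
    · refine Eventually.of_forall fun u => ?_
      refine (tendsto_cosSum_div_sqrt_pow (by omega) u).congr' ?_
      have h1 : Tendsto (fun k : ℕ => Real.pi * √(k : ℝ)) atTop atTop :=
        (Real.tendsto_sqrt_atTop.comp tendsto_natCast_atTop_atTop).const_mul_atTop Real.pi_pos
      filter_upwards [h1.eventually_gt_atTop |u|] with k hk
      rw [Set.indicator_of_mem]
      have := abs_lt.1 hk
      exact ⟨by linarith [this.1], this.2.le⟩
  refine hdom.congr' ?_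
  filter_upwards [eventually_gt_atTop 0] with k hk
  have hk' : (0 : ℝ) < k := by exact_mod_cast hk
  have hs : (0 : ℝ) < √k := Real.sqrt_pos.2 hk'
  have h1 := intervalIntegral.integral_comp_div (a := -Real.pi * √k) (b := Real.pi * √k)
    (fun θ => (cosSum m θ / (m : ℝ) ^ 2) ^ k) hs.ne'
  rw [mul_div_cancel_right₀ _ hs.ne', mul_div_cancel_right₀ _ hs.ne', smul_eq_mul] at h1
  rw [MeasureTheory.integral_indicator measurableSet_Ioc, ← h1,
    intervalIntegral.integral_of_le]
  have := Real.pi_pos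
  nlinarith [mul_pos this hs]

/-! ### Stirling's formula and the asymptotic count. -/

/-- The sequence equals `stirlingSeq (2k) / stirlingSeq k ^ 2` for `k > 0`, with limit `√π / π`. -/
lemma tendsto_centralBinom_mul_sqrt_div :
    Tendsto (fun k : ℕ => (Nat.centralBinom k : ℝ) * √k / 4 ^ k) atTop (𝓝 (1 / √Real.pi)) := by
  have hpi : (0 : ℝ) < √Real.pi := Real.sqrt_pos.2 Real.pi_pos
  have h2 : Tendsto (fun k : ℕ => 2 * k) atTop atTop := tendsto_id.const_mul_atTop' two_pos
  have h := (Stirling.tendsto_stirlingSeq_sqrt_pi.comp h2).div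
    (Stirling.tendsto_stirlingSeq_sqrt_pi.pow 2) (by positivity)
  have e : √Real.pi / √Real.pi ^ 2 = 1 / √Real.pi := by field_simp
  rw [e] at h
  refine h.congr' ?_
  filter_upwards [eventually_gt_atTop 0] with k hk
  have hk' : (0 : ℝ) < k := by exact_mod_cast hk
  have hs : (0 : ℝ) < √k := Real.sqrt_pos.2 hk'
  have hsq : √(k : ℝ) ^ 2 = k := Real.sq_sqrt hk'.le
  have hb : ((2 * k).factorial : ℝ) = Nat.centralBinom k * (k.factorial : ℝ) ^ 2 := by
    rw [Nat.centralBinom_eq_two_mul_choose]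
    have := Nat.choose_mul_factorial_mul_factorial (show k ≤ 2 * k by omega)
    rw [show 2 * k - k = k by omega] at this
    rw [← this]
    push_cast
    ring
  have hf : (k.factorial : ℝ) ≠ 0 := by positivity
  have hr : √(2 * ((2 * k : ℕ) : ℝ)) = 2 * √k := by
    push_cast
    rw [← mul_assoc, Real.sqrt_mul (by norm_num), show (2 * 2 : ℝ) = 2 ^ 2 by norm_num,
      Real.sqrt_sq (by norm_num)]
  have hr2 : √(2 * (k : ℝ)) ^ 2 = 2 * √k ^ 2 := by
    rw [Real.sq_sqrt (by positivity), hsq]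
  have hp : (((2 * k : ℕ) : ℝ) / Real.exp 1) ^ (2 * k) = 4 ^ k * ((k / Real.exp 1) ^ k) ^ 2 := by
    push_cast
    rw [mul_div_assoc, mul_pow, pow_mul, pow_mul', show (2 : ℝ) ^ 2 = 4 by norm_num]
  have hne : ((k : ℝ) / Real.exp 1) ^ k ≠ 0 := by positivity
  simp only [Function.comp, Pi.div_apply, Stirling.stirlingSeq]
  rw [hb, hr, hp]
  generalize ((k : ℝ) / Real.exp 1) ^ k = X at hne
  rw [div_pow, mul_pow, hr2]
  field_simp

lemma tendsto_atTopEven {α : Type*} {f : ℕ → α} {l : Filter α}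
    (h : Tendsto (fun k : ℕ => f (2 * k)) atTop l) : Tendsto f atTopEven l := by
  have h2 : Tendsto (fun n : ℕ => f (2 * (n / 2))) atTopEven l :=
    (h.comp (Nat.tendsto_div_const_atTop two_ne_zero)).mono_left inf_le_left
  refine h2.congr' ?_
  filter_upwards [mem_inf_of_right (mem_principal_self _)] with n hn
  rw [Nat.two_mul_div_two_of_even hn]

lemma tendsto_natCast_atTopEven : Tendsto (fun n : ℕ => (n : ℝ)) atTopEven atTop :=
  tendsto_natCast_atTop_atTop.mono_left inf_le_left

lemma eventually_atTopEven_pos : ∀ᶠ n : ℕ in atTopEven, 0 < n ∧ Even n :=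
  (Eventually.filter_mono inf_le_left (eventually_gt_atTop 0)).and
    (mem_inf_of_right (mem_principal_self _))

lemma tendsto_cpbCount_div {q : ℕ} (hq : 4 ≤ q) (hqe : Even q) :
    Tendsto (fun n : ℕ => (cpbCount n q : ℝ) /
      ((q : ℝ) ^ n * (1 / (Real.pi * n)) * Real.sqrt (48 / ((q : ℝ) ^ 2 - 4))))
      atTopEven (𝓝 1) := by
  obtain ⟨m, rfl⟩ := even_iff_exists_two_mul.1 hqe
  have hm : 2 ≤ m := by omega
  have hm2 : (2 : ℝ) ≤ m := by exact_mod_cast hm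
  have hpi := Real.pi_pos
  have hv : 0 < ((m : ℝ) ^ 2 - 1) / 12 := by nlinarith
  have hsp : 0 < √Real.pi := Real.sqrt_pos.2 hpi
  set v : ℝ := ((m : ℝ) ^ 2 - 1) / 12 with hvdef
  have hsv : 0 < √v := Real.sqrt_pos.2 hv
  refine tendsto_atTopEven ?_
  have h := (tendsto_centralBinom_mul_sqrt_div.mul
    (tendsto_sqrt_mul_integral_cosSum_pow hm)).mul_const (√v)
  have e : 1 / √Real.pi * √(Real.pi / v) * √v = 1 := by
    rw [Real.sqrt_div hpi.le]
    field_simp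
  rw [← hvdef, e] at h
  refine h.congr' ?_
  filter_upwards [eventually_gt_atTop 0] with k hk
  have hk' : (0 : ℝ) < k := by exact_mod_cast hk
  have hs : (0 : ℝ) < √k := Real.sqrt_pos.2 hk'
  have hsq : √(k : ℝ) * √k = k := Real.mul_self_sqrt hk'.le
  have hr : √(48 / (((2 * m : ℕ) : ℝ) ^ 2 - 4)) = 1 / √v := by
    rw [← Real.sqrt_one, ← Real.sqrt_div zero_le_one, hvdef]
    congr 1
    have h1 : (m : ℝ) ^ 2 - 1 ≠ 0 := by nlinarith
    have h2 : ((2 * m : ℕ) : ℝ) ^ 2 - 4 = 4 * ((m : ℝ) ^ 2 - 1) := by push_cast; ring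
    rw [h2]
    field_simp
    norm_num
  have hp : ((2 * m : ℕ) : ℝ) ^ (2 * k) = 4 ^ k * ((m : ℝ) ^ 2) ^ k := by
    push_cast
    rw [pow_mul, mul_pow, mul_pow]
    norm_num
  have hI : ∫ θ in (-Real.pi)..Real.pi, (cosSum m θ / (m : ℝ) ^ 2) ^ k =
      (∫ θ in (-Real.pi)..Real.pi, cosSum m θ ^ k) / ((m : ℝ) ^ 2) ^ k := by
    simp_rw [div_pow _ _ k]
    rw [intervalIntegral.integral_div]
  have hcount := cpbCount_two_mul k m
  rw [hI, hr, hp]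
  generalize ∫ θ in (-Real.pi)..Real.pi, cosSum m θ ^ k = J at hcount
  have hc : (cpbCount (2 * k) (2 * m) : ℝ) = Nat.centralBinom k * J / (2 * Real.pi) := by
    rw [← hcount]
    field_simp
  have hmk : ((m : ℝ) ^ 2) ^ k ≠ 0 := by positivity
  rw [hc]
  generalize ((m : ℝ) ^ 2) ^ k = X at hmk
  push_cast
  -- The two factors `√k`, from Stirling and from Laplace, combine to `k = n/2`.
  calc (Nat.centralBinom k : ℝ) * √k / 4 ^ k * (√k * (J / X)) * √v
      = Nat.centralBinom k * (√k * √k) / 4 ^ k * (J / X) * √v := by ring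
    _ = _ := by
      rw [hsq]
      field_simp

/-! ### Redundancy. -/

/-- Half the entries `1`, half `-1`; both are symbols because `q` is even. -/
lemma cpbSequences_nonempty {n q : ℕ} (hq : 2 ≤ q) (hqe : Even q) (hn : Even n) :
    (cpbSequences n q).Nonempty := by
  classical
  obtain ⟨m, rfl⟩ := even_iff_exists_two_mul.1 hqe
  obtain ⟨k, rfl⟩ := even_iff_exists_two_mul.1 hn
  obtain ⟨s, -, hs⟩ := Finset.exists_subset_card_eq
    (s := (Finset.univ : Finset (Fin (2 * k)))) (n := k) (by simp; omega)
  have hc : sᶜ.card = k := by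
    rw [Finset.card_compl, hs, Fintype.card_fin]
    omega
  have hmem : (fun i => if i ∈ s then (1 : ℤ) else -1) ∈ pamSequences (2 * k) (2 * m) := by
    refine Fintype.mem_piFinset.2 fun i => mem_pamAlphabet_two_mul.2 ?_
    split_ifs <;> omega
  refine ⟨fun i => if i ∈ s then (1 : ℤ) else -1, Finset.mem_filter.2 ⟨hmem, ?_, ?_⟩⟩
  · rw [IsChargeBalanced, ← Finset.sum_add_sum_compl s,
      Finset.sum_congr rfl fun i hi => if_pos hi,
      Finset.sum_congr (s₁ := sᶜ) rfl fun i hi => if_neg (Finset.mem_compl.1 hi)]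
    simp [hs, hc]
  · rw [isPolarityBalanced_iff_card_pos hmem]
    convert! hs
    ext i
    by_cases hi : i ∈ s <;> simp [hi]

/-- Every CPB code lies in `cpbSequences n q`, itself a code, and redundancy decreases with size. -/
lemma isLeast_cpbRedundancies {n q : ℕ} (hq : 1 < q) (h : (cpbSequences n q).Nonempty) :
    IsLeast (cpbRedundancies n q) ((n : ℝ) - Real.logb q (cpbCount n q : ℝ)) := by
  classical
  refine ⟨⟨cpbSequences n q, ⟨h, Finset.filter_subset _ _, fun x hx =>
    (Finset.mem_filter.1 hx).2⟩, rfl⟩, ?_⟩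
  rintro r ⟨C, ⟨hne, hsub, hbal⟩, rfl⟩
  have hC : C ⊆ cpbSequences n q := fun x hx => Finset.mem_filter.2 ⟨hsub hx, hbal x hx⟩
  refine sub_le_sub_left (Real.logb_le_logb_of_le (by exact_mod_cast hq) ?_ ?_) _
  · exact_mod_cast hne.card_pos
  · exact_mod_cast Finset.card_le_card hC

lemma minCPBRedundancy_eq {n q : ℕ} (hq : 2 ≤ q) (hqe : Even q) (hn : Even n) :
    minCPBRedundancy n q = (n : ℝ) - Real.logb q (cpbCount n q : ℝ) :=
  (isLeast_cpbRedundancies hq (cpbSequences_nonempty hq hqe hn)).csInf_eq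

lemma tendsto_minCPBRedundancy_sub {q : ℕ} (hq : 4 ≤ q) (hqe : Even q) :
    Tendsto (fun n : ℕ => minCPBRedundancy n q -
        (Real.logb q n + Real.logb q (Real.pi * Real.sqrt (((q : ℝ) ^ 2 - 4) / 48))))
      atTopEven (𝓝 0) := by
  have hq' : (4 : ℝ) ≤ q := by exact_mod_cast hq
  have hd : (0 : ℝ) < (q : ℝ) ^ 2 - 4 := by nlinarith
  -- The difference to be bounded is exactly `-log_q` of the count ratio, which tends to 1.
  have hlog := ((Real.continuousAt_log one_ne_zero).tendsto.comp
    (tendsto_cpbCount_div hq hqe)).div_const (Real.log q)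
  have hlog' := hlog.neg
  rw [Real.log_one, zero_div, neg_zero] at hlog'
  refine hlog'.congr' ?_
  filter_upwards [eventually_atTopEven_pos] with n hn
  have hn' : (0 : ℝ) < n := by exact_mod_cast hn.1
  have hc : (0 : ℝ) < cpbCount n q := by
    exact_mod_cast (cpbSequences_nonempty (by omega) hqe hn.2).card_pos
  have hs : 0 < √(((q : ℝ) ^ 2 - 4) / 48) := Real.sqrt_pos.2 (by positivity)
  have hinv : √(48 / ((q : ℝ) ^ 2 - 4)) = (√(((q : ℝ) ^ 2 - 4) / 48))⁻¹ := by
    rw [← Real.sqrt_inv, inv_div]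
  have hpi := Real.pi_pos
  have hlq : Real.log q ≠ 0 := (Real.log_pos (by linarith)).ne'
  rw [minCPBRedundancy_eq (by omega) hqe hn.2, hinv]
  simp only [Function.comp, Real.logb]
  rw [Real.log_div hc.ne' (by positivity), Real.log_mul (by positivity) (by positivity),
    Real.log_mul (by positivity) (by positivity), Real.log_pow, Real.log_div one_ne_zero
    (by positivity), Real.log_one, Real.log_mul hpi.ne' hn'.ne', Real.log_inv,
    Real.log_mul hpi.ne' hs.ne']
  field_simp
  ring

theorem mainTheorem1 (q : ℕ) (hq : 4 ≤ q) (hqe : Even q) :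
    ((fun n : ℕ => (cpbCount n q : ℝ)) ~[atTopEven]
      (fun n : ℕ => (q : ℝ) ^ n * (1 / (Real.pi * n)) * Real.sqrt (48 / ((q : ℝ) ^ 2 - 4)))) ∧
    (∀ n : ℕ, 0 < n → Even n →
      IsLeast (cpbRedundancies n q) (minCPBRedundancy n q) ∧
      minCPBRedundancy n q = (n : ℝ) - Real.logb q (cpbCount n q : ℝ)) ∧
    Tendsto (fun n : ℕ => minCPBRedundancy n q -
        (Real.logb q n + Real.logb q (Real.pi * Real.sqrt (((q : ℝ) ^ 2 - 4) / 48))))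
      atTopEven (𝓝 0) ∧
    Tendsto (fun n : ℕ => minCPBRedundancy n q / Real.logb q n) atTopEven (𝓝 1) := by
  have hq' : (4 : ℝ) ≤ q := by exact_mod_cast hq
  have hred := tendsto_minCPBRedundancy_sub hq hqe
  refine ⟨?_, fun n _ hn => ?_, hred, ?_⟩
  · refine (isEquivalent_iff_tendsto_one ?_).2 (tendsto_cpbCount_div hq hqe)
    filter_upwards [eventually_atTopEven_pos] with n hn
    have hn' : (0 : ℝ) < n := by exact_mod_cast hn.1
    have hd : (0 : ℝ) < (q : ℝ) ^ 2 - 4 := by nlinarith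
    have hpi := Real.pi_pos
    have hs : 0 < √(48 / ((q : ℝ) ^ 2 - 4)) := Real.sqrt_pos.2 (by positivity)
    positivity
  · have heq := minCPBRedundancy_eq (by omega : 2 ≤ q) hqe hn
    refine ⟨?_, heq⟩
    rw [heq]
    exact isLeast_cpbRedundancies (by omega) (cpbSequences_nonempty (by omega) hqe hn)
  · have hlog : Tendsto (fun n : ℕ => Real.logb q n) atTopEven atTop :=
      (Real.tendsto_logb_atTop (by linarith)).comp tendsto_natCast_atTopEven
    -- The redundancy minus `log_q n` converges, so dividing it by `log_q n` gives 0.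
    have h := ((hred.add_const
      (Real.logb q (Real.pi * √(((q : ℝ) ^ 2 - 4) / 48)))).div_atTop hlog).add_const 1
    rw [zero_add] at h
    refine h.congr' ?_
    filter_upwards [hlog.eventually_gt_atTop 0] with n hn
    field_simp
    ring
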